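/- Theorem 4. For a function $K:\mathbb R\times\mathbb R\to\mathbb R$ and real input points $a_1<\cdots<a_k$ ($k\ge 1$), a non-zero function $\phi:\mathbb R\to\mathbb R$ is called a kernel packet of degree $k$ if $\phi(x)=\sum_{j=1}^k A_j K(x,a_j)$ for all $x\in\mathbb R$, with some real coefficients $A_1,\dots,A_k$, and the (closed) support of $\phi$ is exactly $[a_1,a_k]$. We say that $K$ admits a kernel packet if there is one of some degree $k\ge 1$ for some points $a_1<\cdots<a_k$. 1. Let $\nu>0$ and $\omega>0$, and suppose that $\nu$ is not a half-integer, that is, $\nu-\tfrac12\notin\{0,1,2,\dots\}$. Then the one-dimensional Matérn correlation function $$K(x,x')=\frac{2^{1-\nu}}{\Gamma(\nu)}\left(\sqrt{2\nu}\,\frac{|x-x'|}{\omega}\right)^{\nu}K_\nu\!\left(\sqrt{2\nu}\,\frac{|x-x'|}{\omega}\right)\quad(x\ne x'),\qquad K(x,x)=1,$$ where $K_\nu(z)=\int_0^\infty e^{-z\cosh t}\cosh(\nu t)\,dt$ ($z>0$) is the modified Bessel function of the second kind, admits no kernel packet. 2. Let $\omega>0$. Then the one-dimensional Gaussian correlation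 function $K(x,x')=\exp\left(-|x-x'|^2/\omega\right)$ admits no kernel packet. -/

import Mathlib

noncomputable section

/-- The modified Bessel function of the second kind, of real order `ν`, at a real argument `z > 0`:
`K_ν(z) = ∫₀^∞ exp (-z cosh t) cosh (ν t) dt` (an absolutely convergent integral when `z > 0`). -/
def besselK (ν z : ℝ) : ℝ :=
  ∫ t in Set.Ioi (0 : ℝ), Real.exp (-z * Real.cosh t) * Real.cosh (ν * t)

/-- The one-dimensional Matérn correlation function with smoothness `ν` and scale `ω`.
On the diagonal, where the Bessel function is singular, it takes its limiting value `1`. -/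
def maternCorrelation (ν ω : ℝ) (x x' : ℝ) : ℝ :=
  if x = x' then 1
  else 2 ^ (1 - ν) / Real.Gamma ν * (Real.sqrt (2 * ν) * (|x - x'| / ω)) ^ ν
    * besselK ν (Real.sqrt (2 * ν) * (|x - x'| / ω))

/-- The one-dimensional Gaussian correlation function with scale `ω`. -/
def gaussianCorrelation (ω : ℝ) (x x' : ℝ) : ℝ :=
  Real.exp (-(|x - x'| ^ 2 / ω))

/-- `φ` is a kernel packet of degree `k` for the correlation function `K` and the input points
`a 0 < ⋯ < a (k - 1)` (with `k ≥ 1`): `φ` is non-zero, it is a linear combination of the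
`K(·, a j)`, and its (closed) support is the interval from the first to the last input point. -/
def IsKernelPacket (K : ℝ → ℝ → ℝ) {k : ℕ} (a : Fin k → ℝ) (φ : ℝ → ℝ) : Prop :=
  StrictMono a ∧ φ ≠ 0 ∧
    (∃ A : Fin k → ℝ, ∀ x, φ x = ∑ j, A j * K x (a j)) ∧
    ∃ hk : 0 < k, tsupport φ = Set.Icc (a ⟨0, hk⟩) (a ⟨k - 1, Nat.sub_lt hk Nat.one_pos⟩)

/-- `K` admits a kernel packet, of some degree and for some input points. -/
def AdmitsKernelPacket (K : ℝ → ℝ → ℝ) : Prop :=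
  ∃ (k : ℕ) (a : Fin k → ℝ) (φ : ℝ → ℝ), IsKernelPacket K a φ

end

open Filter Topology MeasureTheory

/-! A packet vanishes to the right of its last input point, so it suffices that no nontrivial
combination of the translates `K(·, a j)` vanishes there.

Matérn, with `β = ν - 1/2`: by `rpow_mul_besselK`, `z ^ ν K_ν(z)` is a constant times `e^{-z} ∫₀^∞
e^{-s} (s (2z + s)) ^ β ds`. For `z = X - b j` the base equals `2s (X + s/2 - b j)`, so the whole
combination is `e^{-X}` times the integral of a positive weight against `G (X + s/2)`, where `G y =
∑ B j (y - b j) ^ β`. Up to the factor `y ^ β`, `G` is analytic in `h = 1/y` at `0`. If it vanished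
near `h = 0`, its Taylor coefficients would force `∑ B j (b j) ^ n = 0` for all `n`, as `β ∉ ℕ`
keeps the binomial coefficients non-zero, and Vandermonde would give `B = 0`. Hence `G` has a strict
sign near infinity, and so does the integral for large `X`. For `β ∈ ℕ`, `G` is a polynomial and can
vanish identically.

Gaussian: removing `e^{-x²/ω}` leaves an exponential sum with distinct frequencies, and Vandermonde
applies again. -/

/-! ### Moments and signs of sums of shifted powers and of exponentials -/

lemma hasDerivAt_one_sub_mul_rpow (b γ : ℝ) {h : ℝ} (hh : 0 < 1 - b * h) :
    HasDerivAt (fun h : ℝ => (1 - b * h) ^ γ) (-(γ * (b * (1 - b * h) ^ (γ - 1)))) h := by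
  have h1 : HasDerivAt (fun h : ℝ => 1 - b * h) (-b) h := by
    simpa using ((hasDerivAt_id h).const_mul b).const_sub 1
  convert h1.rpow_const (p := γ) (Or.inl hh.ne') using 1
  ring

lemma eventually_one_sub_mul_pos {ι : Type*} [Finite ι] (b : ι → ℝ) :
    ∀ᶠ h in 𝓝 (0 : ℝ), ∀ j, 0 < 1 - b j * h := by
  refine eventually_all.2 fun j => ?_
  have : ContinuousAt (fun h : ℝ => 1 - b j * h) 0 := by fun_prop
  exact this.eventually (lt_mem_nhds (by simp))

/-- If a combination of shifted powers with exponent outside `ℕ` vanishes near infinity (written in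
the variable `h = 1 / y`), then all the moments of its coefficients vanish. -/
lemma moment_eq_zero_of_eventually_rpow {ι : Type*} [Fintype ι] (b : ι → ℝ) (n : ℕ) :
    ∀ (B : ι → ℝ) (γ : ℝ), (∀ m : ℕ, γ ≠ m) →
      (∀ᶠ h in 𝓝 (0 : ℝ), ∑ j, B j * (1 - b j * h) ^ γ = 0) → ∑ j, B j * b j ^ n = 0 := by
  induction n with
  | zero =>
    intro B γ _ h
    simpa using h.self_of_nhds
  | succ n ih =>
    intro B γ hγ h
    have key := ih (fun j => B j * b j) (γ - 1)
      (fun m hm => hγ (m + 1) (by push_cast; linarith)) ?_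
    · rw [← key]
      exact Finset.sum_congr rfl fun j _ => by ring
    · filter_upwards [eventually_eventually_nhds.2 h, eventually_one_sub_mul_pos b] with x hx hpos
      have h1 : HasDerivAt (fun h : ℝ => ∑ j, B j * (1 - b j * h) ^ γ)
          (∑ j, B j * (-(γ * (b j * (1 - b j * x) ^ (γ - 1))))) x :=
        HasDerivAt.fun_sum fun j _ => (hasDerivAt_one_sub_mul_rpow (b j) γ (hpos j)).const_mul (B j)
      have h2 : HasDerivAt (fun h : ℝ => ∑ j, B j * (1 - b j * h) ^ γ) 0 x :=
        (hasDerivAt_const x (0 : ℝ)).congr_of_eventuallyEq hx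
      have h3 := h1.unique h2
      have h4 : (-γ) * ∑ j, B j * b j * (1 - b j * x) ^ (γ - 1) = 0 := by
        rw [← h3, Finset.mul_sum]
        exact Finset.sum_congr rfl fun j _ => by ring
      -- Differentiating brings out the factor `-γ`; `γ ∉ ℕ` makes it non-zero and passes to `γ -
      -- 1`.
      have hγ0 : γ ≠ 0 := by simpa using hγ 0
      simpa [hγ0] using h4

/-- Each derivative multiplies the `j`-th coefficient by `b j`. -/
lemma moment_eq_zero_of_eventually_exp {ι : Type*} [Fintype ι] (b : ι → ℝ) {x₀ : ℝ} (n : ℕ) :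
    ∀ B : ι → ℝ, (∀ᶠ x in 𝓝 x₀, ∑ j, B j * Real.exp (b j * x) = 0) →
      ∑ j, B j * Real.exp (b j * x₀) * b j ^ n = 0 := by
  induction n with
  | zero =>
    intro B h
    simpa using h.self_of_nhds
  | succ n ih =>
    intro B h
    have key := ih (fun j => B j * b j) ?_
    · rw [← key]
      exact Finset.sum_congr rfl fun j _ => by ring
    · filter_upwards [eventually_eventually_nhds.2 h] with x hx
      have h1 : HasDerivAt (fun x : ℝ => ∑ j, B j * Real.exp (b j * x))
          (∑ j, B j * (Real.exp (b j * x) * (b j * 1))) x :=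
        HasDerivAt.fun_sum fun j _ => (((hasDerivAt_id x).const_mul (b j)).exp).const_mul (B j)
      have h2 : HasDerivAt (fun x : ℝ => ∑ j, B j * Real.exp (b j * x)) 0 x :=
        (hasDerivAt_const x (0 : ℝ)).congr_of_eventuallyEq hx
      rw [← h1.unique h2]
      exact Finset.sum_congr rfl fun j _ => by ring

lemma analyticAt_one_sub_mul_rpow (b γ : ℝ) :
    AnalyticAt ℝ (fun h : ℝ => (1 - b * h) ^ γ) 0 := by
  have h1 : AnalyticAt ℝ (fun h : ℝ => 1 - b * h) 0 := by fun_prop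
  have h2 : AnalyticAt ℝ (fun h : ℝ => Real.exp (Real.log (1 - b * h) * γ)) 0 :=
    ((h1.log (by simp)).mul analyticAt_const).rexp
  refine h2.congr ?_
  have : ContinuousAt (fun h : ℝ => 1 - b * h) 0 := by fun_prop
  filter_upwards [this.eventually (lt_mem_nhds (a := 0) (by simp))] with h hh
  rw [Real.rpow_def_of_pos hh]

lemma pos_or_neg_of_continuousOn_Ioi {g : ℝ → ℝ} {M : ℝ} (hg : ContinuousOn g (Set.Ioi M))
    (h0 : ∀ y, M < y → g y ≠ 0) : (∀ y, M < y → 0 < g y) ∨ (∀ y, M < y → g y < 0) := by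
  by_contra! hcon
  obtain ⟨⟨y, hy, hgy⟩, z, hz, hgz⟩ := hcon
  obtain ⟨x, hx, hx0⟩ := isPreconnected_Ioi.intermediate_value (s := Set.Ioi M) hy hz hg ⟨hgy, hgz⟩
  exact h0 x hx hx0

/-- A nontrivial combination of shifted powers with exponent outside `ℕ` has a strict sign near
infinity. -/
lemma eventually_pos_or_neg_sum_rpow {k : ℕ} {b B : Fin k → ℝ} (hb : Function.Injective b)
    (hB : B ≠ 0) {γ : ℝ} (hγ : ∀ m : ℕ, γ ≠ m) :
    ∃ M : ℝ, (∀ j, b j < M) ∧ ((∀ y, M < y → 0 < ∑ j, B j * (y - b j) ^ γ) ∨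
      (∀ y, M < y → ∑ j, B j * (y - b j) ^ γ < 0)) := by
  have han : AnalyticAt ℝ (fun h : ℝ => ∑ j, B j * (1 - b j * h) ^ γ) 0 :=
    Finset.analyticAt_fun_sum _ fun j _ =>
      analyticAt_const.mul (analyticAt_one_sub_mul_rpow (b j) γ)
  -- Zeros of an analytic function are isolated unless it vanishes near `h = 0`.
  rcases han.eventually_eq_zero_or_eventually_ne_zero with h | h
  · exact absurd (Matrix.eq_zero_of_forall_pow_sum_mul_pow_eq_zero hb fun i =>
      moment_eq_zero_of_eventually_rpow b i B γ hγ h) hB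
  · have h' : ∀ᶠ y : ℝ in atTop, ∑ j, B j * (1 - b j * y⁻¹) ^ γ ≠ 0 :=
      (tendsto_inv_atTop_nhdsGT_zero.mono_right
        (nhdsWithin_mono _ fun x hx => ne_of_gt hx)).eventually h
    have hpos : ∀ᶠ y : ℝ in atTop, ∀ j, b j < y := eventually_all.2 fun j => eventually_gt_atTop _
    obtain ⟨M, hM⟩ := (h'.and (hpos.and (eventually_gt_atTop 0))).exists_forall_of_atTop
    refine ⟨M, (hM M le_rfl).2.1, pos_or_neg_of_continuousOn_Ioi ?_ fun y hy => ?_⟩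
    · refine continuousOn_finsetSum _ fun j _ => continuousOn_const.mul ?_
      refine ContinuousOn.rpow_const (by fun_prop) fun y hy => Or.inl ?_
      exact (sub_pos.2 ((hM y (le_of_lt hy)).2.1 j)).ne'
    · obtain ⟨hne, hlt, hy0⟩ := hM y hy.le
      have : ∑ j, B j * (y - b j) ^ γ = y ^ γ * ∑ j, B j * (1 - b j * y⁻¹) ^ γ := by
        rw [Finset.mul_sum]
        refine Finset.sum_congr rfl fun j _ => ?_
        have e : y - b j = y * (1 - b j * y⁻¹) := by field_simp
        have hp : 0 ≤ 1 - b j * y⁻¹ := by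
          have : 0 < y * (1 - b j * y⁻¹) := e ▸ sub_pos.2 (hlt j)
          exact (pos_of_mul_pos_right this hy0.le).le
        rw [e, Real.mul_rpow hy0.le hp]
        ring
      rw [this]
      exact mul_ne_zero (Real.rpow_pos_of_pos hy0 _).ne' hne

/-! ### Laplace-type representation of the Bessel function -/

/-- The integral `∫₀^∞ u ^ (ν - 1) exp (-(u + w² / u) / 2) du`, equal to `2 w ^ ν K_ν(w)`. -/
noncomputable def besselMixture (ν w : ℝ) : ENNReal :=
  ∫⁻ u in Set.Ioi (0 : ℝ), ENNReal.ofReal (u ^ (ν - 1) * Real.exp (-((u + w ^ 2 / u) / 2)))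

/-- The substitution `u = w e^t` turns `u + w² / u` into `2 w cosh t`. -/
lemma besselMixture_eq_lintegral_exp (ν : ℝ) {w : ℝ} (hw : 0 < w) :
    besselMixture ν w = ENNReal.ofReal (w ^ ν) *
      ∫⁻ t : ℝ, ENNReal.ofReal (Real.exp (-w * Real.cosh t) * Real.exp (ν * t)) := by
  have himg : (fun t : ℝ => w * Real.exp t) '' Set.univ = Set.Ioi 0 := by
    ext u
    simp only [Set.image_univ, Set.mem_range, Set.mem_Ioi]
    refine ⟨fun ⟨t, ht⟩ => ht ▸ by positivity, fun hu => ⟨Real.log (u / w), ?_⟩⟩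
    rw [Real.exp_log (by positivity)]
    field_simp
  rw [besselMixture, ← himg, lintegral_image_eq_lintegral_abs_deriv_mul MeasurableSet.univ
    (f' := fun t => w * Real.exp t)
    (fun t _ => ((Real.hasDerivAt_exp t).const_mul w).hasDerivWithinAt)
    (fun s _ t _ h => Real.exp_injective (mul_left_cancel₀ hw.ne' h)),
    Measure.restrict_univ, ← lintegral_const_mul' _ _ ENNReal.ofReal_ne_top]
  refine lintegral_congr fun t => ?_
  have hp : 0 < w * Real.exp t := by positivity
  rw [← ENNReal.ofReal_mul (abs_nonneg _), ← ENNReal.ofReal_mul (by positivity), abs_of_pos hp,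
    ← mul_assoc, Real.rpow_sub_one hp.ne', mul_div_cancel₀ _ hp.ne',
    Real.mul_rpow hw.le (Real.exp_pos t).le, ← Real.exp_mul, Real.cosh_eq, Real.exp_neg t]
  have e1 : -((w * Real.exp t + w ^ 2 / (w * Real.exp t)) / 2) =
      -w * ((Real.exp t + (Real.exp t)⁻¹) / 2) := by field_simp
  rw [e1, mul_comm t ν]
  ring_nf

lemma lintegral_exp_eq_lintegral_cosh (ν w : ℝ) :
    ∫⁻ t : ℝ, ENNReal.ofReal (Real.exp (-w * Real.cosh t) * Real.exp (ν * t)) =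
      ∫⁻ t : ℝ, ENNReal.ofReal (Real.exp (-w * Real.cosh t) * Real.cosh (ν * t)) := by
  set I := ∫⁻ t : ℝ, ENNReal.ofReal (Real.exp (-w * Real.cosh t) * Real.exp (ν * t)) with hI
  have hneg : ∫⁻ t : ℝ, ENNReal.ofReal (Real.exp (-w * Real.cosh t) * Real.exp (-(ν * t))) = I := by
    rw [hI, ← (Measure.measurePreserving_neg (volume : Measure ℝ)).lintegral_comp
      (by fun_prop)]
    exact lintegral_congr fun t => by simp
  have hsum : 2 * ∫⁻ t : ℝ, ENNReal.ofReal (Real.exp (-w * Real.cosh t) * Real.cosh (ν * t)) =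
      2 * I := by
    rw [two_mul I]
    nth_rewrite 2 [← hneg]
    rw [hI, ← lintegral_add_left (by fun_prop), ← lintegral_const_mul' _ _ (by simp)]
    refine lintegral_congr fun t => ?_
    rw [← ENNReal.ofReal_add (by positivity) (by positivity),
      show (2 : ENNReal) = ENNReal.ofReal 2 by simp, ← ENNReal.ofReal_mul (by norm_num),
      Real.cosh_eq (ν * t)]
    congr 1
    ring
  exact ((ENNReal.mul_right_inj (by simp) (by simp)).1 hsum).symm

lemma besselK_eq_toReal_lintegral (ν z : ℝ) :
    2 * besselK ν z =
      (∫⁻ t : ℝ, ENNReal.ofReal (Real.exp (-z * Real.cosh t) * Real.cosh (ν * t))).toReal := by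
  rw [besselK, ← integral_comp_abs
    (f := fun t => Real.exp (-z * Real.cosh t) * Real.cosh (ν * t)), integral_eq_lintegral_of_nonneg_ae]
  · congr 1
    refine lintegral_congr fun t => ?_
    rw [Real.cosh_abs, ← Real.cosh_abs (ν * |t|), abs_mul, abs_abs, ← abs_mul, Real.cosh_abs]
  · exact ae_of_all _ fun t => by
      have := Real.cosh_pos (ν * |t|)
      dsimp
      positivity
  · exact (by fun_prop : Continuous _).aestronglyMeasurable

/-- Since `cosh t = 1 + 2 sinh² (t/2)`, the substitution `v = sinh (t/2)` gives a Gaussian integral.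
-/
lemma lintegral_exp_neg_mul_cosh_mul_cosh_half {w : ℝ} (hw : 0 < w) :
    ∫⁻ t : ℝ, ENNReal.ofReal (Real.exp (-w * Real.cosh t) * Real.cosh (-(1 / 2) * t)) =
      ENNReal.ofReal (Real.sqrt (2 * Real.pi / w) * Real.exp (-w)) := by
  have himg : (fun t : ℝ => Real.sinh (t / 2)) '' Set.univ = Set.univ := by
    rw [Set.image_univ, Set.range_eq_univ]
    intro v
    obtain ⟨t, ht⟩ := Real.sinh_surjective v
    exact ⟨2 * t, by simpa using ht⟩
  have hgauss : ∫⁻ v : ℝ, ENNReal.ofReal (2 * Real.exp (-w) * Real.exp (-(2 * w) * v ^ 2)) =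
      ENNReal.ofReal (Real.sqrt (2 * Real.pi / w) * Real.exp (-w)) := by
    rw [← ofReal_integral_eq_lintegral_ofReal
      ((integrable_exp_neg_mul_sq (by positivity)).const_mul _)
      (ae_of_all _ fun v => by dsimp; positivity), integral_const_mul, integral_gaussian]
    have : 2 * Real.pi / w = 2 ^ 2 * (Real.pi / (2 * w)) := by field_simp
    rw [this, Real.sqrt_mul (by norm_num), Real.sqrt_sq (by norm_num)]
    congr 1
    ring
  rw [← hgauss, ← setLIntegral_univ, ← setLIntegral_univ (μ := volume) (fun v : ℝ =>
    ENNReal.ofReal (2 * Real.exp (-w) * Real.exp (-(2 * w) * v ^ 2)))]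
  nth_rewrite 2 [← himg]
  rw [lintegral_image_eq_lintegral_abs_deriv_mul MeasurableSet.univ
    (f := fun t => Real.sinh (t / 2)) (f' := fun t => Real.cosh (t / 2) * (1 / 2))
    (fun t _ => (((hasDerivAt_id t).div_const 2).sinh).hasDerivWithinAt)
    (fun s _ t _ h => by simpa using Real.sinh_injective h)]
  refine lintegral_congr fun t => ?_
  have hc := Real.cosh_pos (t / 2)
  rw [← ENNReal.ofReal_mul (abs_nonneg _), abs_of_pos (by positivity)]
  congr 1
  have e1 : Real.cosh t = 1 + 2 * Real.sinh (t / 2) ^ 2 := by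
    have h1 := Real.cosh_two_mul (t / 2)
    have h2 := Real.cosh_sq (t / 2)
    rw [mul_div_cancel₀ t (by norm_num : (2 : ℝ) ≠ 0)] at h1
    linarith
  have e2 : Real.cosh (-(1 / 2) * t) = Real.cosh (t / 2) := by
    rw [← Real.cosh_neg]
    congr 1
    ring
  have e3 : Real.exp (-w * Real.cosh t) =
      Real.exp (-w) * Real.exp (-(2 * w) * Real.sinh (t / 2) ^ 2) := by
    rw [← Real.exp_add, e1]
    congr 1
    ring
  rw [e2, e3]
  ring

lemma besselMixture_neg_half {w : ℝ} (hw : 0 < w) :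
    besselMixture (-(1 / 2)) w =
      ENNReal.ofReal (Real.sqrt (2 * Real.pi) * Real.exp (-w) / w) := by
  rw [besselMixture_eq_lintegral_exp _ hw, lintegral_exp_eq_lintegral_cosh,
    lintegral_exp_neg_mul_cosh_mul_cosh_half hw, ← ENNReal.ofReal_mul (by positivity)]
  congr 1
  rw [Real.sqrt_div (by positivity), Real.rpow_neg hw.le, ← Real.sqrt_eq_rpow]
  have h0 := Real.sqrt_pos.2 hw
  field_simp
  rw [Real.sq_sqrt hw.le]

/-- The substitution `y = s (2z + s)`, with `dy = 2 (z + s) ds`, gives a Gamma integral. -/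
lemma lintegral_shifted_gamma {z u β : ℝ} (hz : 0 < z) (hu : 0 < u) (hβ : -1 < β) :
    ∫⁻ s in Set.Ioi (0 : ℝ), ENNReal.ofReal
      ((z + s) * (s * (2 * z + s)) ^ β * Real.exp (-(s * (2 * z + s) / (2 * u)))) =
      ENNReal.ofReal (2 ^ β * Real.Gamma (β + 1) * u ^ (β + 1)) := by
  have himg : (fun s : ℝ => s * (2 * z + s)) '' Set.Ioi 0 = Set.Ioi 0 := by
    ext y
    simp only [Set.mem_image, Set.mem_Ioi]
    refine ⟨fun ⟨s, hs, h⟩ => h ▸ by positivity, fun hy => ⟨Real.sqrt (z ^ 2 + y) - z, ?_, ?_⟩⟩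
    · exact sub_pos.2 (Real.lt_sqrt_of_sq_lt (by linarith))
    · have := Real.sq_sqrt (show 0 ≤ z ^ 2 + y by positivity)
      linear_combination this
  have hint : ∫ y in Set.Ioi (0 : ℝ), y ^ β * Real.exp (-(1 / (2 * u) * y)) =
      (2 * u) ^ (β + 1) * Real.Gamma (β + 1) := by
    have := Real.integral_rpow_mul_exp_neg_mul_Ioi (a := β + 1) (r := 1 / (2 * u))
      (by linarith) (by positivity)
    simpa using this
  have hgam : ∫⁻ y in Set.Ioi (0 : ℝ),
      ENNReal.ofReal (1 / 2 * (y ^ β * Real.exp (-(1 / (2 * u) * y)))) =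
      ENNReal.ofReal (2 ^ β * Real.Gamma (β + 1) * u ^ (β + 1)) := by
    rw [← ofReal_integral_eq_lintegral_ofReal, integral_const_mul, hint,
      Real.mul_rpow (by norm_num) hu.le, Real.rpow_add_one (by norm_num)]
    · congr 1
      ring
    · have := integrableOn_rpow_mul_exp_neg_mul_rpow (p := 1) (b := 1 / (2 * u)) hβ
        one_pos (by positivity)
      simp only [Real.rpow_one, neg_mul] at this
      exact this.const_mul _
    · filter_upwards [self_mem_ae_restrict measurableSet_Ioi] with y hy
      have : (0 : ℝ) < y := hy
      dsimp
      positivity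
  rw [← hgam]
  nth_rewrite 2 [← himg]
  rw [lintegral_image_eq_lintegral_abs_deriv_mul measurableSet_Ioi
    (f := fun s => s * (2 * z + s)) (f' := fun s => 2 * (z + s))]
  · refine setLIntegral_congr_fun measurableSet_Ioi fun s hs => ?_
    have hs : (0 : ℝ) < s := hs
    rw [← ENNReal.ofReal_mul (abs_nonneg _), abs_of_pos (by positivity)]
    congr 1
    rw [show 1 / (2 * u) * (s * (2 * z + s)) = s * (2 * z + s) / (2 * u) by ring]
    ring
  · intro s _
    have := (hasDerivAt_id' s).fun_mul ((hasDerivAt_id' s).const_add (2 * z))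
    refine HasDerivAt.hasDerivWithinAt ?_
    exact this.congr_deriv (by ring)
  · intro s hs t ht h
    have hs : (0 : ℝ) < s := hs
    have ht : (0 : ℝ) < t := ht
    have h : s * (2 * z + s) = t * (2 * z + t) := h
    have h2 : (s - t) * (2 * z + s + t) = 0 := by linear_combination h
    rcases mul_eq_zero.1 h2 with h3 | h3 <;> linarith

/-- Write `e^{-(z+s)} / (z + s)` as a mixture of order `-1/2` and integrate over `s` first. As `(z +
s)² = z² + s (2z + s)`, the inner integral contributes `u ^ (β + 1)`, raising the order to `β +
1/2`. -/
lemma lintegral_rpow_mul_exp_eq_besselMixture {z β : ℝ} (hz : 0 < z) (hβ : -1 < β) :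
    ENNReal.ofReal (Real.sqrt (2 * Real.pi)) *
      ∫⁻ s in Set.Ioi (0 : ℝ), ENNReal.ofReal ((s * (2 * z + s)) ^ β * Real.exp (-(z + s))) =
    ENNReal.ofReal (2 ^ β * Real.Gamma (β + 1)) * besselMixture (β + 1 / 2) z := by
  have hΓ : 0 < Real.Gamma (β + 1) := Real.Gamma_pos_of_pos (by linarith)
  calc
    _ = ∫⁻ s in Set.Ioi (0 : ℝ), ∫⁻ u in Set.Ioi (0 : ℝ),
        ENNReal.ofReal ((z + s) * (s * (2 * z + s)) ^ β) *
          ENNReal.ofReal (u ^ (-(1 / 2) - 1 : ℝ) * Real.exp (-((u + (z + s) ^ 2 / u) / 2))) := by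
      rw [← lintegral_const_mul' _ _ ENNReal.ofReal_ne_top]
      refine setLIntegral_congr_fun measurableSet_Ioi fun s hs => ?_
      have hs : (0 : ℝ) < s := hs
      have hzs : 0 < z + s := by positivity
      rw [lintegral_const_mul' _ _ ENNReal.ofReal_ne_top, ← besselMixture,
        besselMixture_neg_half hzs, ← ENNReal.ofReal_mul (by positivity),
        ← ENNReal.ofReal_mul (by positivity)]
      congr 1
      field_simp
    _ = ∫⁻ u in Set.Ioi (0 : ℝ), ∫⁻ s in Set.Ioi (0 : ℝ),
        ENNReal.ofReal ((z + s) * (s * (2 * z + s)) ^ β) *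
          ENNReal.ofReal (u ^ (-(1 / 2) - 1 : ℝ) * Real.exp (-((u + (z + s) ^ 2 / u) / 2))) := by
      -- Tonelli: with values in `[0, ∞]`, only measurability is needed.
      refine lintegral_lintegral_swap (Measurable.aemeasurable ?_)
      unfold Function.uncurry
      fun_prop
    _ = ∫⁻ u in Set.Ioi (0 : ℝ), ENNReal.ofReal (2 ^ β * Real.Gamma (β + 1)) *
        ENNReal.ofReal (u ^ (β + 1 / 2 - 1) * Real.exp (-((u + z ^ 2 / u) / 2))) := by
      refine setLIntegral_congr_fun measurableSet_Ioi fun u hu => ?_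
      have hu : (0 : ℝ) < u := hu
      have h1 : ∀ s ∈ Set.Ioi (0 : ℝ), ENNReal.ofReal ((z + s) * (s * (2 * z + s)) ^ β) *
          ENNReal.ofReal (u ^ (-(1 / 2) - 1 : ℝ) * Real.exp (-((u + (z + s) ^ 2 / u) / 2))) =
          ENNReal.ofReal (u ^ (-(1 / 2) - 1 : ℝ) * Real.exp (-((u + z ^ 2 / u) / 2))) *
          ENNReal.ofReal
            ((z + s) * (s * (2 * z + s)) ^ β * Real.exp (-(s * (2 * z + s) / (2 * u)))) := by
        intro s hs
        have hs : (0 : ℝ) < s := hs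
        rw [← ENNReal.ofReal_mul (by positivity), ← ENNReal.ofReal_mul (by positivity)]
        have e : Real.exp (-((u + (z + s) ^ 2 / u) / 2)) =
            Real.exp (-((u + z ^ 2 / u) / 2)) * Real.exp (-(s * (2 * z + s) / (2 * u))) := by
          rw [← Real.exp_add]
          congr 1
          field_simp
          ring
        rw [e]
        congr 1
        ring
      rw [setLIntegral_congr_fun measurableSet_Ioi h1,
        lintegral_const_mul' _ _ ENNReal.ofReal_ne_top, lintegral_shifted_gamma hz hu hβ,
        ← ENNReal.ofReal_mul (by positivity), ← ENNReal.ofReal_mul (by positivity)]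
      have e : u ^ (β + 1 / 2 - 1) = u ^ (-(1 / 2) - 1 : ℝ) * u ^ (β + 1) := by
        rw [← Real.rpow_add hu]
        congr 1
        ring
      rw [e]
      congr 1
      ring
    _ = _ := by
      rw [lintegral_const_mul' _ _ ENNReal.ofReal_ne_top, besselMixture]

/-- `z ^ ν K_ν(z)` as a Laplace-type integral, valid for `ν > -1/2`. -/
lemma rpow_mul_besselK {z β : ℝ} (hz : 0 < z) (hβ : -1 < β) :
    z ^ (β + 1 / 2) * besselK (β + 1 / 2) z =
      Real.sqrt (2 * Real.pi) / (2 * (2 ^ β * Real.Gamma (β + 1))) *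
        (Real.exp (-z) * ∫ s in Set.Ioi (0 : ℝ), Real.exp (-s) * (s * (2 * z + s)) ^ β) := by
  have hΓ : 0 < Real.Gamma (β + 1) := Real.Gamma_pos_of_pos (by linarith)
  have h := congrArg ENNReal.toReal (lintegral_rpow_mul_exp_eq_besselMixture hz hβ)
  rw [besselMixture_eq_lintegral_exp _ hz, lintegral_exp_eq_lintegral_cosh] at h
  simp only [ENNReal.toReal_mul] at h
  rw [← besselK_eq_toReal_lintegral, ENNReal.toReal_ofReal (by positivity),
    ENNReal.toReal_ofReal (by positivity), ENNReal.toReal_ofReal (by positivity),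
    ← integral_eq_lintegral_of_nonneg_ae] at h
  · have e : ∫ s in Set.Ioi (0 : ℝ), (s * (2 * z + s)) ^ β * Real.exp (-(z + s)) =
        Real.exp (-z) * ∫ s in Set.Ioi (0 : ℝ), Real.exp (-s) * (s * (2 * z + s)) ^ β := by
      rw [← integral_const_mul]
      congr 1
      ext s
      rw [neg_add, Real.exp_add]
      ring
    rw [e] at h
    rw [div_mul_eq_mul_div, h]
    field_simp
  · filter_upwards [self_mem_ae_restrict measurableSet_Ioi] with s hs
    have : (0 : ℝ) < s := hs
    dsimp
    positivity
  · exact (by fun_prop : Measurable _).aestronglyMeasurable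

/-- For `z > |β|`, `(1 + s / (2z)) ^ β ≤ e^{s/2}`, so half of the exponential decay remains to
dominate with `s ^ β e^{-s/2}`. -/
lemma integrableOn_exp_neg_mul_rpow {z β : ℝ} (hβ : -1 < β) (hz : |β| < z) :
    IntegrableOn (fun s : ℝ => Real.exp (-s) * (s * (2 * z + s)) ^ β) (Set.Ioi 0) := by
  have hz0 : 0 < z := (abs_nonneg β).trans_lt hz
  have hdom := (integrableOn_rpow_mul_exp_neg_mul_rpow (p := 1) (b := 1 / 2) hβ
    one_pos (by norm_num)).const_mul ((2 * z) ^ β)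
  simp only [Real.rpow_one] at hdom
  refine Integrable.mono' hdom (by fun_prop : Measurable _).aestronglyMeasurable ?_
  filter_upwards [self_mem_ae_restrict measurableSet_Ioi] with s hs
  have hs : (0 : ℝ) < s := hs
  rw [Real.norm_of_nonneg (by positivity)]
  have h1 : (1 + s / (2 * z)) ^ β ≤ Real.exp (s / 2) := by
    have hq : 0 ≤ s / (2 * z) := by positivity
    calc (1 + s / (2 * z)) ^ β ≤ (1 + s / (2 * z)) ^ |β| :=
          Real.rpow_le_rpow_of_exponent_le (by linarith) (le_abs_self β)
      _ ≤ (Real.exp (s / (2 * z))) ^ |β| :=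
          Real.rpow_le_rpow (by positivity) (by linarith [Real.add_one_le_exp (s / (2 * z))])
            (abs_nonneg β)
      _ = Real.exp (s / (2 * z) * |β|) := by rw [← Real.exp_mul]
      _ ≤ Real.exp (s / 2) := by
          refine Real.exp_le_exp.2 ?_
          calc s / (2 * z) * |β| ≤ s / (2 * z) * z := by gcongr
            _ = s / 2 := by field_simp
  have h2 : (s * (2 * z + s)) ^ β = (2 * z) ^ β * s ^ β * (1 + s / (2 * z)) ^ β := by
    rw [← Real.mul_rpow (by positivity) hs.le, ← Real.mul_rpow (by positivity) (by positivity)]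
    congr 1
    field_simp
  have h3 : Real.exp (-s) = Real.exp (-(1 / 2) * s) * Real.exp (-(s / 2)) := by
    rw [← Real.exp_add]
    congr 1
    ring
  calc Real.exp (-s) * (s * (2 * z + s)) ^ β
      = (2 * z) ^ β * (s ^ β * Real.exp (-(1 / 2) * s)) *
        (Real.exp (-(s / 2)) * (1 + s / (2 * z)) ^ β) := by rw [h2, h3]; ring
    _ ≤ (2 * z) ^ β * (s ^ β * Real.exp (-(1 / 2) * s)) *
        (Real.exp (-(s / 2)) * Real.exp (s / 2)) := by gcongr
    _ = _ := by rw [← Real.exp_add]; simp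

/-! ### Non-vanishing to the right of the input points, and the theorem -/

lemma IsKernelPacket.exists_coeff {K : ℝ → ℝ → ℝ} {k : ℕ} {a : Fin k → ℝ} {φ : ℝ → ℝ}
    (h : IsKernelPacket K a φ) :
    ∃ A : Fin k → ℝ, A ≠ 0 ∧ ∀ x, (∀ j, a j < x) → ∑ j, A j * K x (a j) = 0 := by
  obtain ⟨-, hφ, ⟨A, hA⟩, hk, hsupp⟩ := h
  refine ⟨A, ?_, fun x hx => ?_⟩
  · rintro rfl
    exact hφ (funext fun x => by simp [hA])
  · rw [← hA]
    refine image_eq_zero_of_notMem_tsupport fun hmem => ?_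
    rw [hsupp] at hmem
    exact absurd hmem.2 (not_le.2 (hx _))

lemma setIntegral_Ioi_pos {f : ℝ → ℝ} (hf : IntegrableOn f (Set.Ioi 0))
    (hpos : ∀ s, 0 < s → 0 < f s) : 0 < ∫ s in Set.Ioi (0 : ℝ), f s := by
  rw [setIntegral_pos_iff_support_of_nonneg_ae ?_ hf]
  · have : Function.support f ∩ Set.Ioi 0 = Set.Ioi 0 :=
      Set.inter_eq_right.2 fun s hs => (hpos s hs).ne'
    simp [this]
  · filter_upwards [self_mem_ae_restrict measurableSet_Ioi] with s hs
    exact (hpos s hs).le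

/-- A nontrivial combination of translates of `s ↦ z ^ ν K_ν(z)` cannot vanish near infinity unless
`ν` is a half-integer. -/
lemma exists_sum_exp_mul_integral_ne_zero {k : ℕ} {b A : Fin k → ℝ} (hb : Function.Injective b)
    (hA : A ≠ 0) {β : ℝ} (hβ : -1 < β) (hβn : ∀ m : ℕ, β ≠ m) :
    ∃ X : ℝ, (∀ j, b j < X) ∧ ∑ j, A j * (Real.exp (-(X - b j)) *
      ∫ s in Set.Ioi (0 : ℝ), Real.exp (-s) * (s * (2 * (X - b j) + s)) ^ β) ≠ 0 := by
  set B : Fin k → ℝ := fun j => A j * Real.exp (b j) with hBdef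
  have hB : B ≠ 0 := by
    intro h
    refine hA (funext fun j => ?_)
    simpa [hBdef] using congrFun h j
  obtain ⟨M, hM, hsign⟩ := eventually_pos_or_neg_sum_rpow hb hB hβn
  -- `M < X` puts every `X + s/2` in the region of constant sign; `b j + |β| < X` gives
  -- integrability.
  obtain ⟨X, hX⟩ : ∃ X : ℝ, M < X ∧ ∀ j, b j + |β| < X :=
    ((eventually_gt_atTop M).and
      (eventually_all.2 fun j => eventually_gt_atTop (b j + |β|))).exists
  have hbX : ∀ j, b j < X := fun j => (hM j).trans hX.1
  refine ⟨X, hbX, ?_⟩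
  have hint : ∀ j, IntegrableOn
      (fun s : ℝ => B j * (Real.exp (-s) * (s * (2 * (X - b j) + s)) ^ β)) (Set.Ioi 0) := fun j =>
    (integrableOn_exp_neg_mul_rpow hβ (by linarith [hX.2 j])).const_mul (B j)
  have hsum := integrable_finsetSum Finset.univ fun j _ => hint j
  set F : ℝ → ℝ := fun s => ∑ j, B j * (Real.exp (-s) * (s * (2 * (X - b j) + s)) ^ β) with hF
  have hFs : ∀ s, 0 < s → F s =
      Real.exp (-s) * (2 * s) ^ β * ∑ j, B j * (X + s / 2 - b j) ^ β := by
    intro s hs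
    rw [hF, Finset.mul_sum]
    refine Finset.sum_congr rfl fun j _ => ?_
    have h0 : 0 < X + s / 2 - b j := by linarith [hbX j]
    have e : s * (2 * (X - b j) + s) = 2 * s * (X + s / 2 - b j) := by ring
    rw [e, Real.mul_rpow (by positivity) h0.le]
    ring
  have htotal : ∑ j, A j * (Real.exp (-(X - b j)) *
      ∫ s in Set.Ioi (0 : ℝ), Real.exp (-s) * (s * (2 * (X - b j) + s)) ^ β) =
      Real.exp (-X) * ∫ s in Set.Ioi (0 : ℝ), F s := by
    rw [integral_finsetSum _ fun j _ => hint j, Finset.mul_sum]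
    refine Finset.sum_congr rfl fun j _ => ?_
    rw [integral_const_mul, neg_sub, sub_eq_add_neg, Real.exp_add, hBdef]
    ring
  rw [htotal]
  refine mul_ne_zero (Real.exp_pos _).ne' ?_
  rcases hsign with h | h
  · refine (setIntegral_Ioi_pos hsum fun s hs => ?_).ne'
    rw [hFs s hs]
    exact mul_pos (by positivity) (h _ (by linarith [hX.1]))
  · have := setIntegral_Ioi_pos hsum.neg fun s hs => by
      rw [Pi.neg_apply, hFs s hs, ← mul_neg]
      exact mul_pos (by positivity) (neg_pos.2 (h _ (by linarith [hX.1])))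
    simp only [Pi.neg_apply, integral_neg] at this
    exact (neg_pos.1 this).ne

theorem theorem4 :
    (∀ ν ω : ℝ, 0 < ν → 0 < ω → (¬ ∃ n : ℕ, ν = (n : ℝ) + 1 / 2) →
      ¬ AdmitsKernelPacket (maternCorrelation ν ω)) ∧
    (∀ ω : ℝ, 0 < ω → ¬ AdmitsKernelPacket (gaussianCorrelation ω)) := by
  constructor
  · rintro ν ω hν hω hhalf ⟨k, a, φ, hp⟩
    have ha := hp.1.injective
    obtain ⟨A, hA, hzero⟩ := hp.exists_coeff
    obtain ⟨β, rfl⟩ : ∃ β, ν = β + 1 / 2 := ⟨ν - 1 / 2, by ring⟩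
    have hβ : -1 < β := by linarith
    have hβn : ∀ m : ℕ, β ≠ m := fun m hm => hhalf ⟨m, by rw [hm]⟩
    -- In the variable `X = κ x` the Bessel argument becomes `X - κ a j`, a pure translate.
    set κ : ℝ := Real.sqrt (2 * (β + 1 / 2)) / ω with hκ
    have hκ0 : 0 < κ := by positivity
    obtain ⟨X, hX, hne⟩ := exists_sum_exp_mul_integral_ne_zero (b := fun j => κ * a j)
      (fun i j h => ha (mul_left_cancel₀ hκ0.ne' h)) hA hβ hβn
    have hlt : ∀ j, a j < X / κ := fun j => by
      rw [lt_div_iff₀ hκ0, mul_comm]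
      exact hX j
    have hz := hzero (X / κ) hlt
    have h1 := Real.Gamma_pos_of_pos hν
    have h2 : 0 < Real.Gamma (β + 1) := Real.Gamma_pos_of_pos (by linarith)
    obtain ⟨c, hc, hc0⟩ : ∃ c : ℝ, c = 2 ^ (1 - (β + 1 / 2)) / Real.Gamma (β + 1 / 2) *
          (Real.sqrt (2 * Real.pi) / (2 * (2 ^ β * Real.Gamma (β + 1)))) ∧ 0 < c :=
      ⟨_, rfl, by positivity⟩
    have hK : ∀ j, maternCorrelation (β + 1 / 2) ω (X / κ) (a j) = c *
        (Real.exp (-(X - κ * a j)) *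
          ∫ s in Set.Ioi (0 : ℝ), Real.exp (-s) * (s * (2 * (X - κ * a j) + s)) ^ β) := by
      intro j
      have e : Real.sqrt (2 * (β + 1 / 2)) * (|X / κ - a j| / ω) = X - κ * a j := by
        rw [abs_of_pos (sub_pos.2 (hlt j)), mul_div_left_comm, ← hκ]
        field_simp
      rw [maternCorrelation, if_neg (hlt j).ne', e, mul_assoc,
        rpow_mul_besselK (sub_pos.2 (hX j)) hβ, hc]
      ring
    simp only [hK, mul_left_comm (A _) c, ← Finset.mul_sum] at hz
    exact mul_ne_zero hc0.ne' hne hz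
  · rintro ω hω ⟨k, a, φ, hp⟩
    have ha := hp.1.injective
    obtain ⟨A, hA, hzero⟩ := hp.exists_coeff
    obtain ⟨x₀, hx₀⟩ : ∃ x₀ : ℝ, ∀ j, a j < x₀ :=
      (eventually_all.2 fun j => eventually_gt_atTop (a j)).exists
    have hnear : ∀ᶠ x in nhds x₀, ∀ j, a j < x :=
      eventually_all.2 fun j => lt_mem_nhds (hx₀ j)
    -- Expanding `(x - a j)²` gives the frequencies `b j`; the factor `e^{-(a j)²/ω}` goes into `B
    -- j`.
    set b : Fin k → ℝ := fun j => 2 * a j / ω with hb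
    set B : Fin k → ℝ := fun j => A j * Real.exp (-(a j ^ 2 / ω)) with hB
    have hexp : ∀ᶠ x in nhds x₀, ∑ j, B j * Real.exp (b j * x) = 0 := by
      filter_upwards [hnear] with x hx
      have e : ∑ j, A j * gaussianCorrelation ω x (a j) =
          Real.exp (-(x ^ 2 / ω)) * ∑ j, B j * Real.exp (b j * x) := by
        rw [Finset.mul_sum]
        refine Finset.sum_congr rfl fun j _ => ?_
        have : gaussianCorrelation ω x (a j) =
            Real.exp (-(x ^ 2 / ω)) * Real.exp (-(a j ^ 2 / ω)) * Real.exp (b j * x) := by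
          rw [gaussianCorrelation, ← Real.exp_add, ← Real.exp_add, sq_abs, hb]
          congr 1
          ring
        rw [this, hB]
        ring
      have h := hzero x hx
      rw [e] at h
      exact (mul_eq_zero.1 h).resolve_left (Real.exp_pos _).ne'
    have hbinj : Function.Injective b := fun i j h => by
      have h : 2 * a i / ω = 2 * a j / ω := h
      field_simp at h
      exact ha h
    have hcoeff := Matrix.eq_zero_of_forall_pow_sum_mul_pow_eq_zero hbinj fun i =>
      moment_eq_zero_of_eventually_exp b i B hexp
    refine hA (funext fun j => ?_)
    simpa [hB] using congrFun hcoeff j
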